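/- All sets live in the category $\mathsf{Set}$, and all indexed preorders are indexed over $\mathsf{Set}$. **Indexed preorders.** An *indexed preorder* $\mathcal H$ is a pseudofunctor from $\mathsf{Set}^{\mathrm{op}}$ to preorders and monotone maps; elements of $\mathcal H(I)$ are called predicates on $I$, and $f^*:\mathcal H(I)\to\mathcal H(J)$ denotes the monotone map induced by $f:J\to I$. Two indexed preorders are *equivalent* if there are pseudonatural transformations between them in both directions that are mutually inverse up to isomorphism. $\mathcal H$ *has finite meets* if every fiber $\mathcal H(I)$ has finite meets and these are preserved by all $f^*$. It *has existential* (resp. *universal*) *quantification* if every $f^*$ has a left adjoint $\exists_f$ (resp. a right adjoint $\forall_f$) satisfying the Beck–Chevalley condition for all pullback squares of sets. It *has implication* if every fiber has finite meets and Heyting implication, and reindexing preserves this structure up to isomorphism. A predicate $\iota\in\mathcal H(A)$ is *generic* if for every set $B$ and $\varphi\in\mathcal H(B)$ there is $f:B\to A$ with $f^*\iota\cong\varphi$. A predicate $\delta\in\mathcal H(I)$ is *discrete* if for every surjection $e:K\to J$, function $f:K\to I$ and $\varphi\in\mathcal H(J)$ with $e^*\varphi\le f^*\delta$ there is $g:J\to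 I$ with $g\circ e=f$. A *tripos* is an indexed preorder with finite meets, universal quantification, implication and a generic predicate; a tripos also has existential quantification. **$\exists$-prime predicates.** Let $\mathcal H$ be an indexed preorder with existential quantification. A predicate $\pi\in\mathcal H(I)$ is *$\exists$-prime* if for all functions $u:J\to I$, $v:K\to J$ and all $\varphi\in\mathcal H(K)$ with $u^*\pi\le\exists_v\varphi$ there is $s:J\to K$ with $v\circ s=\mathrm{id}_J$ and $u^*\pi\le s^*\varphi$. Let $\mathsf{prim}(\mathcal H)$ be the indexed sub-preorder of $\exists$-prime predicates. $\mathcal H$ *has enough $\exists$-prime predicates* if for every $\varphi\in\mathcal H(I)$ there are $u:J\to I$ and an $\exists$-prime $\pi\in\mathcal H(J)$ with $\exists_u\pi\cong\varphi$. **Relative realizability triposes.** A *relative PCA* $(A,\cdot,A_\#)$ is a set $A$ with a partial binary operation $\cdot$ (associating to the left) and a subset $A_\#\subseteq A$ such that $a\cdot b\in A_\#$ whenever $a,b\in A_\#$ and $a\cdot b$ is defined, and such that there are $\mathsf k,\mathsf s\in A_\#$ with, for all $a,b,c\in A$: $\mathsf k\cdot a\cdot b$ is defined and equal to $a$; $\mathsf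 s\cdot a\cdot b$ is defined; and $\mathsf s\cdot a\cdot b\cdot c$ is defined if and only if $a\cdot c\cdot(b\cdot c)$ is, in which case the two are equal. The *relative realizability tripos* over $(A,\cdot,A_\#)$ is the indexed preorder whose predicates on $I$ are the functions $I\to P(A)$, ordered by $$\varphi\le\psi\iff \exists e\in A_\#\;\forall i\in I\;\forall a\in\varphi(i):\ e\cdot a\text{ is defined and } e\cdot a\in\psi(i),$$ with reindexing given by precomposition. **Theorem.** For every tripos $\mathcal P$ the following are equivalent. 1. $\mathcal P$ is equivalent to the relative realizability tripos over some relative PCA. 2. $\mathcal P$ has enough $\exists$-prime predicates, and $\mathsf{prim}(\mathcal P)$ has finite meets and a discrete generic predicate. -/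

import Mathlib

universe u v w

set_option linter.checkUnivs false in
/-- A (`Set`-)indexed preorder: a pseudofunctor from `Setᵒᵖ` to the locally ordered category of
preorders and monotone maps. `Set` is `Type u`; the coherence conditions of a pseudofunctor hold
automatically, since its values are preorders. -/
structure IndexedPreorder where
  /-- the predicates on `I`, that is, the fiber over `I` -/
  Pred : Type u → Type v
  [preorder : ∀ I, Preorder (Pred I)]
  /-- reindexing along a function -/
  reindex : ∀ {I J : Type u}, (J → I) → (Pred I →o Pred J)
  reindex_id : ∀ {I : Type u} (φ : Pred I), AntisymmRel (· ≤ ·) (reindex id φ) φ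
  reindex_comp : ∀ {I J K : Type u} (f : J → I) (g : K → J) (φ : Pred I),
    AntisymmRel (· ≤ ·) (reindex (f ∘ g) φ) (reindex g (reindex f φ))

attribute [instance] IndexedPreorder.preorder

/-- Pullback squares of sets: `vbar`, `ubar` are the projections of a pullback of `f` and `g`. -/
structure IsPullbackSquare {I J K L : Type u} (vbar : L → J) (ubar : L → K)
    (f : J → I) (g : K → I) : Prop where
  comm : ∀ l, f (vbar l) = g (ubar l)
  existsUnique : ∀ j k, f j = g k → ∃! l, vbar l = j ∧ ubar l = k

namespace IndexedPreorder

/-- Isomorphism of predicates on the same set. -/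
abbrev Iso (H : IndexedPreorder.{u, v}) {I : Type u} (φ ψ : H.Pred I) : Prop :=
  AntisymmRel (· ≤ ·) φ ψ

/-- Indexed monotone maps (pseudonatural transformations). -/
structure Hom (H : IndexedPreorder.{u, v}) (K : IndexedPreorder.{u, w}) where
  app : ∀ I : Type u, H.Pred I →o K.Pred I
  naturality : ∀ {I J : Type u} (f : J → I) (φ : H.Pred I),
    K.Iso (app J (H.reindex f φ)) (K.reindex f (app I φ))

/-- Equivalence of indexed preorders: there are indexed monotone maps in both directions that are
mutually inverse up to isomorphism. -/
def IsEquivalent (H : IndexedPreorder.{u, v}) (K : IndexedPreorder.{u, w}) : Prop :=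
  ∃ (F : Hom H K) (G : Hom K H),
    (∀ (I : Type u) (φ : H.Pred I), H.Iso (G.app I (F.app I φ)) φ) ∧
    (∀ (I : Type u) (ψ : K.Pred I), K.Iso (F.app I (G.app I ψ)) ψ)

/-- `ι` is a generic predicate. -/
def IsGeneric (H : IndexedPreorder.{u, v}) {A : Type u} (ι : H.Pred A) : Prop :=
  ∀ (B : Type u) (φ : H.Pred B), ∃ f : B → A, H.Iso (H.reindex f ι) φ

/-- `δ` is a discrete predicate. -/
def IsDiscrete (H : IndexedPreorder.{u, v}) {I : Type u} (δ : H.Pred I) : Prop :=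
  ∀ (J K : Type u) (e : K → J) (f : K → I) (φ : H.Pred J), Function.Surjective e →
    H.reindex e φ ≤ H.reindex f δ → ∃ g : J → I, g ∘ e = f

/-- An indexed meet-semilattice: the fibers have finite meets, and reindexing preserves them. -/
structure HasFiniteMeets (H : IndexedPreorder.{u, v}) : Prop where
  exists_top : ∀ I : Type u, ∃ t : H.Pred I, IsTop t
  exists_inf : ∀ (I : Type u) (φ ψ : H.Pred I), ∃ m, IsGLB {φ, ψ} m
  reindex_top : ∀ {I J : Type u} (f : J → I) (t : H.Pred I), IsTop t → IsTop (H.reindex f t)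
  reindex_inf : ∀ {I J : Type u} (f : J → I) (φ ψ m : H.Pred I), IsGLB {φ, ψ} m →
    IsGLB {H.reindex f φ, H.reindex f ψ} (H.reindex f m)

/-- `θ` is a Heyting implication `φ ⇒ ψ` (in a fiber with binary meets): a value at `ψ` of a right
adjoint to `(- ∧ φ)`. -/
def IsImp (H : IndexedPreorder.{u, v}) {I : Type u} (φ ψ θ : H.Pred I) : Prop :=
  ∀ ζ m : H.Pred I, IsGLB {ζ, φ} m → (m ≤ ψ ↔ ζ ≤ θ)

/-- The fibers have Heyting implications, and reindexing preserves them. -/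
structure HasImplication (H : IndexedPreorder.{u, v}) : Prop where
  exists_imp : ∀ (I : Type u) (φ ψ : H.Pred I), ∃ θ, H.IsImp φ ψ θ
  reindex_imp : ∀ {I J : Type u} (f : J → I) (φ ψ θ : H.Pred I), H.IsImp φ ψ θ →
    H.IsImp (H.reindex f φ) (H.reindex f ψ) (H.reindex f θ)

/-- `χ` is a universal quantification `∀_f φ`: a value at `φ` of a right adjoint to `f^*`. -/
def IsForall (H : IndexedPreorder.{u, v}) {I J : Type u} (f : J → I) (φ : H.Pred J)
    (χ : H.Pred I) : Prop :=
  ∀ ψ : H.Pred I, ψ ≤ χ ↔ H.reindex f ψ ≤ φ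

/-- `χ` is an existential quantification `∃_f φ`: a value at `φ` of a left adjoint to `f^*`. -/
def IsExists (H : IndexedPreorder.{u, v}) {I J : Type u} (f : J → I) (φ : H.Pred J)
    (χ : H.Pred I) : Prop :=
  ∀ ψ : H.Pred I, χ ≤ ψ ↔ φ ≤ H.reindex f ψ

/-- Universal quantification along all functions, with the Beck–Chevalley condition. -/
structure HasUniversalQuantification (H : IndexedPreorder.{u, v}) : Prop where
  exists_forall : ∀ {I J : Type u} (f : J → I) (φ : H.Pred J), ∃ χ, H.IsForall f φ χ
  beckChevalley : ∀ {I J K L : Type u} (vbar : L → J) (ubar : L → K) (f : J → I) (g : K → I),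
    IsPullbackSquare vbar ubar f g → ∀ (φ : H.Pred K) (χ : H.Pred I), H.IsForall g φ χ →
      H.IsForall vbar (H.reindex ubar φ) (H.reindex f χ)

/-- Existential quantification along all functions, with the Beck–Chevalley condition. -/
structure HasExistentialQuantification (H : IndexedPreorder.{u, v}) : Prop where
  exists_exists : ∀ {I J : Type u} (f : J → I) (φ : H.Pred J), ∃ χ, H.IsExists f φ χ
  beckChevalley : ∀ {I J K L : Type u} (vbar : L → J) (ubar : L → K) (f : J → I) (g : K → I),
    IsPullbackSquare vbar ubar f g → ∀ (φ : H.Pred K) (χ : H.Pred I), H.IsExists g φ χ →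
      H.IsExists vbar (H.reindex ubar φ) (H.reindex f χ)

/-- A tripos: an indexed meet-semilattice with universal quantification, implication, and a
generic predicate. -/
structure IsTripos (P : IndexedPreorder.{u, v}) : Prop where
  hasFiniteMeets : P.HasFiniteMeets
  hasUniversalQuantification : P.HasUniversalQuantification
  hasImplication : P.HasImplication
  exists_generic : ∃ (A : Type u) (ι : P.Pred A), P.IsGeneric ι

/-- Triposes have existential quantification (by a second order encoding), so that the notion of
`∃`-prime predicate below makes sense for them. -/
theorem IsTripos.hasExistentialQuantification {P : IndexedPreorder.{u, v}} (hP : P.IsTripos) :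
    P.HasExistentialQuantification := by
  have hM := hP.hasFiniteMeets
  have hU := hP.hasUniversalQuantification
  have hI := hP.hasImplication
  have ex : ∀ {I J : Type u} (f : J → I) (φ : P.Pred J), ∃ χ, P.IsExists f φ χ := by
    intro I J f φ
    obtain ⟨A, ι, hι⟩ := hP.exists_generic
    let p : I × A → I := Prod.fst
    let pJ : J × A → J := Prod.fst
    let F : J × A → I × A := fun x => (f x.1, x.2)
    let t : P.Pred (I × A) := P.reindex Prod.snd ι
    obtain ⟨α, hα⟩ := hI.exists_imp _ (P.reindex pJ φ) (P.reindex F t)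
    obtain ⟨β, hβ⟩ := hU.exists_forall F α
    obtain ⟨γ, hγ⟩ := hI.exists_imp _ β t
    obtain ⟨χ, hχ⟩ := hU.exists_forall p γ
    have sq1 : IsPullbackSquare pJ F f p :=
      ⟨fun _ => rfl, fun j k h => ⟨(j, k.2), ⟨rfl, Prod.ext h rfl⟩, fun y hy =>
        Prod.ext hy.1 (show (F y).2 = k.2 by rw [hy.2])⟩⟩
    have unit : φ ≤ P.reindex f χ := by
      rw [hU.beckChevalley pJ F f p sq1 γ χ hχ]
      obtain ⟨m, hm⟩ := hM.exists_inf _ (P.reindex pJ φ) (P.reindex F β)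
      rw [← hI.reindex_imp F β t γ hγ _ m hm]
      have h1 : P.reindex F β ≤ α := (hβ β).1 le_rfl
      have hm' : IsGLB {P.reindex F β, P.reindex pJ φ} m := by rwa [Set.pair_comm]
      exact (hα _ m hm').2 h1
    have key : ∀ ψ : P.Pred I, φ ≤ P.reindex f ψ → χ ≤ ψ := by
      intro ψ hψ
      obtain ⟨g, hg⟩ := hι I ψ
      let s : I → I × A := fun i => (i, g i)
      let s' : J → J × A := fun j => (j, g (f j))
      have sq2 : IsPullbackSquare f s' s F := by
        refine ⟨fun _ => rfl, fun i k h => ⟨k.1, ⟨?_, ?_⟩, fun y hy => congrArg Prod.fst hy.2⟩⟩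
        · exact (congrArg Prod.fst h).symm
        · have h1 : i = f k.1 := congrArg Prod.fst h
          have h2 : g i = k.2 := congrArg Prod.snd h
          exact Prod.ext rfl (by rw [← h2, h1])
      have hχγ : P.reindex p χ ≤ γ := (hχ χ).1 le_rfl
      have h1 : χ ≤ P.reindex s γ :=
        calc χ ≤ P.reindex (p ∘ s) χ := (P.reindex_id χ).2
          _ ≤ P.reindex s (P.reindex p χ) := (P.reindex_comp p s χ).1
          _ ≤ P.reindex s γ := (P.reindex s).monotone hχγ
      have hst : P.reindex s t ≤ ψ :=
        (P.reindex_comp (Prod.snd : I × A → A) s ι).2.trans hg.1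
      have h2 : χ ≤ P.reindex s β := by
        rw [hU.beckChevalley f s' s F sq2 α β hβ]
        obtain ⟨m, hm⟩ := hM.exists_inf _ (P.reindex f χ) (P.reindex s' (P.reindex pJ φ))
        rw [← hI.reindex_imp s' _ _ α hα _ m hm]
        calc m ≤ P.reindex s' (P.reindex pJ φ) := hm.1 (by simp)
          _ ≤ P.reindex (pJ ∘ s') φ := (P.reindex_comp pJ s' φ).2
          _ ≤ φ := (P.reindex_id φ).1
          _ ≤ P.reindex f ψ := hψ
          _ ≤ P.reindex f (P.reindex g ι) := (P.reindex f).monotone hg.2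
          _ ≤ P.reindex (g ∘ f) ι := (P.reindex_comp g f ι).2
          _ ≤ P.reindex (F ∘ s') (P.reindex Prod.snd ι) :=
            (P.reindex_comp (Prod.snd : I × A → A) (F ∘ s') ι).1
          _ ≤ P.reindex s' (P.reindex F t) := (P.reindex_comp F s' t).1
      obtain ⟨m, hm⟩ := hM.exists_inf _ χ (P.reindex s β)
      refine le_trans ?_ hst
      refine le_trans ?_ ((hI.reindex_imp s β t γ hγ χ m hm).2 h1)
      exact hm.2 (by simp [h2])
    exact ⟨χ, fun ψ => ⟨fun h => unit.trans ((P.reindex f).monotone h), key ψ⟩⟩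
  refine ⟨ex, ?_⟩
  intro I J K L vbar ubar f g hsq φ χ hχ ψ
  obtain ⟨θ, hθ⟩ := hU.exists_forall f ψ
  have hsq' : IsPullbackSquare ubar vbar g f :=
    ⟨fun l => (hsq.comm l).symm, fun k j h => by
      simpa only [and_comm] using hsq.existsUnique j k h.symm⟩
  rw [← hθ χ, hχ θ]
  exact hU.beckChevalley ubar vbar g f hsq' ψ θ hθ φ

/-- `∃`-prime predicates, in an indexed preorder with existential quantification. The inequality
`f^* π ≤ ∃_g φ` does not depend on the choice of `∃_g φ`, which is unique up to isomorphism. -/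
def IsExPrime (H : IndexedPreorder.{u, v}) {I : Type u} (π : H.Pred I) : Prop :=
  ∀ (J K : Type u) (f : J → I) (g : K → J) (φ : H.Pred K) (χ : H.Pred J), H.IsExists g φ χ →
    H.reindex f π ≤ χ → ∃ s : J → K, g ∘ s = id ∧ H.reindex f π ≤ H.reindex s φ

theorem IsExPrime.reindex {H : IndexedPreorder.{u, v}} {I I' : Type u} {π : H.Pred I}
    (hπ : H.IsExPrime π) (h : I' → I) : H.IsExPrime (H.reindex h π) := by
  intro J K f g φ χ hχ hle
  obtain ⟨s, hs, hs'⟩ := hπ J K (h ∘ f) g φ χ hχ ((H.reindex_comp h f π).1.trans hle)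
  exact ⟨s, hs, (H.reindex_comp h f π).2.trans hs'⟩

/-- The indexed sub-preorder of `∃`-prime predicates. -/
def prim (H : IndexedPreorder.{u, v}) : IndexedPreorder.{u, v} where
  Pred I := {π : H.Pred I // H.IsExPrime π}
  reindex f := ⟨fun π => ⟨H.reindex f π.1, π.2.reindex f⟩, fun _ _ h => (H.reindex f).monotone h⟩
  reindex_id π := H.reindex_id π.1
  reindex_comp f g π := H.reindex_comp f g π.1

/-- Every predicate is isomorphic to `∃_f π` for some function `f` and `∃`-prime predicate `π`. -/
def HasEnoughExPrimes (H : IndexedPreorder.{u, v}) : Prop :=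
  ∀ (I : Type u) (φ : H.Pred I), ∃ (J : Type u) (f : J → I) (π : H.Pred J),
    H.IsExPrime π ∧ H.IsExists f π φ

end IndexedPreorder

/-- Application of partial elements, for a partial binary operation: it is defined iff both
arguments are defined and the operation is defined at their values. -/
def partialApp {A : Type u} (app : A → A → Part A) (x y : Part A) : Part A :=
  x.bind fun a => y.bind fun b => app a b

/-- Relative PCAs: a set `A` with a partial binary application, and a subset `sharp` that is closed
under application and contains combinators `k` and `s` with `k a b = a`, `s a b` defined, and
`s a b c` defined iff `a c (b c)` is, with the same value (equality of elements of `Part A` is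
Kleene equality). -/
structure RelPCA (A : Type u) where
  app : A → A → Part A
  sharp : Set A
  app_mem_sharp : ∀ a ∈ sharp, ∀ b ∈ sharp, ∀ c ∈ app a b, c ∈ sharp
  exists_k : ∃ k ∈ sharp, ∀ a b : A,
    partialApp app (partialApp app (.some k) (.some a)) (.some b) = .some a
  exists_s : ∃ s ∈ sharp, ∀ a b : A,
    (partialApp app (partialApp app (.some s) (.some a)) (.some b)).Dom ∧
    ∀ c : A,
      partialApp app (partialApp app (partialApp app (.some s) (.some a)) (.some b)) (.some c) =
        partialApp app (partialApp app (.some a) (.some c)) (partialApp app (.some b) (.some c))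

namespace RelPCA

variable {A : Type u} (𝔸 : RelPCA A)

/-- `φ ≤ ψ` for `φ ψ : I → Set A`: there is `e ∈ sharp` such that for all `i` and `a ∈ φ i`, the
application `e a` is defined and lies in `ψ i`. -/
def Realizes {I : Type u} (φ ψ : I → Set A) : Prop :=
  ∃ e ∈ 𝔸.sharp, ∀ i, ∀ a ∈ φ i, ∃ b ∈ 𝔸.app e a, b ∈ ψ i

theorem exists_comp {f g : A} (hf : f ∈ 𝔸.sharp) (hg : g ∈ 𝔸.sharp) :
    ∃ e ∈ 𝔸.sharp, ∀ a : A, 𝔸.app e a = (𝔸.app g a).bind fun b => 𝔸.app f b := by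
  obtain ⟨k, hk, hk'⟩ := 𝔸.exists_k
  obtain ⟨s, hs, hs'⟩ := 𝔸.exists_s
  simp only [partialApp, Part.bind_some] at hk' hs'
  have hf' : f ∈ (𝔸.app k f).bind fun a => 𝔸.app a f := by rw [hk']; exact Part.mem_some f
  obtain ⟨kf, hkf, -⟩ := Part.mem_bind_iff.1 hf'
  have ekf := Part.eq_some_iff.2 hkf
  have hkx : ∀ x, 𝔸.app kf x = Part.some f := fun x => by
    have := hk' f x
    rwa [ekf, Part.bind_some] at this
  obtain ⟨hd, hc⟩ := hs' kf g
  obtain ⟨e, he⟩ := Part.dom_iff_mem.1 hd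
  obtain ⟨skf, h1, h2⟩ := Part.mem_bind_iff.1 he
  refine ⟨e, 𝔸.app_mem_sharp _ (𝔸.app_mem_sharp _ hs _ (𝔸.app_mem_sharp _ hk _ hf _ hkf) _ h1)
    _ hg _ h2, fun a => ?_⟩
  have := hc a
  rwa [Part.eq_some_iff.2 he, Part.bind_some, hkx, Part.bind_some] at this

theorem exists_id : ∃ e ∈ 𝔸.sharp, ∀ a : A, 𝔸.app e a = Part.some a := by
  obtain ⟨k, hk, hk'⟩ := 𝔸.exists_k
  obtain ⟨s, hs, hs'⟩ := 𝔸.exists_s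
  simp only [partialApp, Part.bind_some] at hk' hs'
  obtain ⟨hd, hc⟩ := hs' k k
  obtain ⟨e, he⟩ := Part.dom_iff_mem.1 hd
  obtain ⟨sk, h1, h2⟩ := Part.mem_bind_iff.1 he
  refine ⟨e, 𝔸.app_mem_sharp _ (𝔸.app_mem_sharp _ hs _ hk _ h1) _ hk _ h2, fun a => ?_⟩
  have := hc a
  rw [Part.eq_some_iff.2 he, Part.bind_some] at this
  rw [this]
  have hka : a ∈ (𝔸.app k a).bind fun c => 𝔸.app c a := by rw [hk']; exact Part.mem_some a
  obtain ⟨ka, h3, -⟩ := Part.mem_bind_iff.1 hka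
  have := hk' a ka
  rw [Part.eq_some_iff.2 h3, Part.bind_some] at this ⊢
  rw [Part.bind_some, this]

theorem Realizes.refl {I : Type u} (φ : I → Set A) : 𝔸.Realizes φ φ := by
  obtain ⟨e, he, h⟩ := 𝔸.exists_id
  exact ⟨e, he, fun i a ha => ⟨a, by rw [h]; exact Part.mem_some a, ha⟩⟩

theorem Realizes.trans {I : Type u} {φ ψ χ : I → Set A} (h₁ : 𝔸.Realizes φ ψ)
    (h₂ : 𝔸.Realizes ψ χ) : 𝔸.Realizes φ χ := by
  obtain ⟨e, he, h⟩ := h₁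
  obtain ⟨f, hf, h'⟩ := h₂
  obtain ⟨d, hd, hd'⟩ := 𝔸.exists_comp hf he
  refine ⟨d, hd, fun i a ha => ?_⟩
  obtain ⟨b, hb, hb'⟩ := h i a ha
  obtain ⟨c, hc, hc'⟩ := h' i b hb'
  exact ⟨c, by rw [hd']; exact Part.mem_bind hb hc, hc'⟩

/-- The fiber over `I` of the relative realizability tripos: the functions `I → Set A`, preordered
by `Realizes`. -/
abbrev fiberPreorder (I : Type u) : Preorder (I → Set A) where
  le φ ψ := 𝔸.Realizes φ ψ
  lt φ ψ := 𝔸.Realizes φ ψ ∧ ¬ 𝔸.Realizes ψ φ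
  le_refl φ := Realizes.refl 𝔸 φ
  le_trans _ _ _ h₁ h₂ := Realizes.trans 𝔸 h₁ h₂
  lt_iff_le_not_ge _ _ := Iff.rfl

/-- The relative realizability tripos over a relative PCA; reindexing is precomposition. -/
def realizabilityTripos : IndexedPreorder.{u, u} where
  Pred I := I → Set A
  preorder I := 𝔸.fiberPreorder I
  reindex {I J} f := @OrderHom.mk _ _ (𝔸.fiberPreorder I) (𝔸.fiberPreorder J) (fun φ => φ ∘ f) (by
    rintro φ ψ ⟨e, he, h⟩
    exact ⟨e, he, fun j a ha => h (f j) a ha⟩)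
  reindex_id φ := ⟨Realizes.refl 𝔸 φ, Realizes.refl 𝔸 φ⟩
  reindex_comp f g φ := ⟨Realizes.refl 𝔸 _, Realizes.refl 𝔸 _⟩

end RelPCA

-- From a discrete generic `∃`-prime `δ` on `A` a computability relation is read off: `f : I → A`
-- stands for the predicate `f^* δ`, and `Le f g` means `f^* δ ≤ g^* δ`. Discreteness makes `g` a
-- function of `f`, and finite meets of primes give pairing. For evaluation, the predicate Θ(R) = ∀
-- (b, v) ∈ R, δ b ⇒ δ v, on subsets R of `A × A`, says that R is tracked. Covering Θ by a prime
-- `q^* δ` supplies codes, and since the terminal predicate is prime, each valid inequality `f^* δ ≤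
-- g^* δ` has a global code.
--
-- Coded evaluation with parameters satisfies the law of `s` only in one direction: `s a b c` may be
-- defined when `a c (b c)` is not. `Tracking.Star` repairs this by letting substitution codes
-- converge only when the prescribed computation does. Tags keep all other codes untouched, so the
-- same functions remain computable, now in a relative PCA.
--
-- With enough primes every predicate is an existential image of some `f^* δ`, hence corresponds to
-- a family of subsets of `A`. Primality turns inequalities into sections (`le_iff_exists_section`),
-- and these are realizers.
--
-- Conversely, in a realizability tripos the `∃`-primes are, up to isomorphism, the families of
-- singletons. The family `{a}` over `A` is generic and discrete, and pairing gives meets. All of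
-- this is invariant under equivalence.

-- Abstract computability

/-- An abstract notion of computability on `A`: `Le f g` says that some computable partial function
sends `f i` to `g i` for all `i`. There are computable pairings, and a computable partial
evaluation by which every computable partial function is represented by a global element. -/
structure Tracking (A : Type u) where
  Le : ∀ {I : Type u}, (I → A) → (I → A) → Prop
  refl : ∀ {I : Type u} (f : I → A), Le f f
  trans : ∀ {I : Type u} {f g h : I → A}, Le f g → Le g h → Le f h
  comp : ∀ {I J : Type u} {f g : I → A} (h : J → I), Le f g → Le (f ∘ h) (g ∘ h)
  functional : ∀ {I : Type u} {f g : I → A}, Le f g → ∀ {i j}, f i = f j → g i = g j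
  pair : A → A → A
  pair_fst : ∀ {I : Type u} (f g : I → A), Le (fun i => pair (f i) (g i)) f
  pair_snd : ∀ {I : Type u} (f g : I → A), Le (fun i => pair (f i) (g i)) g
  le_pair : ∀ {I : Type u} {f g h : I → A}, Le h f → Le h g → Le h (fun i => pair (f i) (g i))
  unit : A
  le_unit : ∀ {I : Type u} (f : I → A), Le f (fun _ => unit)
  Eval : A → A → A → Prop
  le_of_eval : ∀ {I : Type u} {f g h : I → A}, (∀ i, Eval (f i) (g i) (h i)) →
    Le (fun i => pair (f i) (g i)) h
  exists_code : ∀ {I : Type u} {f g : I → A}, Le f g →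
    ∃ c, Le (fun _ : PUnit.{u + 1} => unit) (fun _ => c) ∧ ∀ i, Eval c (f i) (g i)

namespace Tracking

variable {A : Type u} (T : Tracking A)

/-- The elements named by a computable function from the terminal set. -/
def Global (c : A) : Prop := T.Le (fun _ : PUnit.{u + 1} => T.unit) (fun _ => c)

variable {T}

theorem Global.le {c : A} (hc : T.Global c) {I : Type u} (f : I → A) : T.Le f (fun _ => c) :=
  T.trans (T.le_unit f) (T.comp (fun _ => PUnit.unit) hc)

theorem Global.pair {a b : A} (ha : T.Global a) (hb : T.Global b) : T.Global (T.pair a b) :=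
  T.le_pair ha hb

variable (T)

/-- The projections are computable, hence functional; functionality is tested on a two-element index
set. -/
theorem pair_injective {a b a' b' : A} (h : T.pair a b = T.pair a' b') : a = a' ∧ b = b' := by
  let f : ULift.{u} Bool → A := fun i => bif i.down then a else a'
  let g : ULift.{u} Bool → A := fun i => bif i.down then b else b'
  have e : T.pair (f ⟨true⟩) (g ⟨true⟩) = T.pair (f ⟨false⟩) (g ⟨false⟩) := h
  exact ⟨T.functional (T.pair_fst f g) (i := ⟨true⟩) (j := ⟨false⟩) e,
    T.functional (T.pair_snd f g) (i := ⟨true⟩) (j := ⟨false⟩) e⟩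

theorem eval_unique {a b c c' : A} (h : T.Eval a b c) (h' : T.Eval a b c') : c = c' := by
  let g : ULift.{u} Bool → A := fun i => bif i.down then c else c'
  have := T.le_of_eval (f := fun _ => a) (g := fun _ => b) (h := g)
    (by rintro ⟨_ | _⟩ <;> assumption)
  exact T.functional this (i := ⟨true⟩) (j := ⟨false⟩) rfl

/-- Application of codes with parameters. -/
def Dot (a b v : A) : Prop := ∃ c x, a = T.pair c x ∧ T.Eval c (T.pair x b) v

theorem le_of_dot {I : Type u} {f g h : I → A} (H : ∀ i, T.Dot (f i) (g i) (h i)) :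
    T.Le (fun i => T.pair (f i) (g i)) h := by
  choose c x hf hv using H
  have h0 : T.Le (fun i => T.pair (f i) (g i)) (fun i => T.pair (c i) (x i)) := by
    have := T.pair_fst f g
    rwa [funext hf] at this ⊢
  exact T.trans (T.le_pair (T.trans h0 (T.pair_fst c x))
    (T.le_pair (T.trans h0 (T.pair_snd c x)) (T.pair_snd f g))) (T.le_of_eval hv)

theorem dot_unique {a b c c' : A} (h : T.Dot a b c) (h' : T.Dot a b c') : c = c' := by
  let g : ULift.{u} Bool → A := fun i => bif i.down then c else c'
  have := T.le_of_dot (f := fun _ => a) (g := fun _ => b) (h := g)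
    (by rintro ⟨_ | _⟩ <;> assumption)
  exact T.functional this (i := ⟨true⟩) (j := ⟨false⟩) rfl

/-- The largest restriction of `Dot` that is strict on the codes `c (x, y)` of the substitution
combinator. -/
inductive Star (c : A → A → A) : A → A → A → Prop
  | subst {x y z p q r : A} : Star c x z p → Star c y z q → Star c p q r → Star c (c x y) z r
  | dot {a b r : A} : (∀ x y, a ≠ c x y) → T.Dot a b r → Star c a b r

theorem Star.to_dot {c : A → A → A}
    (hc : ∀ {x y z p q r : A}, T.Dot x z p → T.Dot y z q → T.Dot p q r → T.Dot (c x y) z r)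
    {a b r : A} (h : T.Star c a b r) : T.Dot a b r := by
  induction h with
  | subst _ _ _ h₁ h₂ h₃ => exact hc h₁ h₂ h₃
  | dot _ h => exact h

/-- This equivalence is the Kleene equality demanded of `s`: the clause `dot` is barred on
substitution codes, and injectivity of `c` recovers the arguments. -/
theorem star_subst_iff {c : A → A → A} (hc : ∀ {x y x' y'}, c x y = c x' y' → x = x' ∧ y = y')
    {x y z r : A} :
    T.Star c (c x y) z r ↔ ∃ p, T.Star c x z p ∧ ∃ q, T.Star c y z q ∧ T.Star c p q r := by
  constructor
  · intro h
    generalize ha : c x y = a at h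
    cases h with
    | subst h₁ h₂ h₃ =>
      obtain ⟨rfl, rfl⟩ := hc ha
      exact ⟨_, h₁, _, h₂, h₃⟩
    | dot h _ => exact absurd ha.symm (h x y)
  · rintro ⟨p, h₁, q, h₂, h₃⟩
    exact .subst h₁ h₂ h₃

end Tracking

-- From abstract computability to a relative PCA

/-- The partial operation with a given graph. -/
noncomputable def partOfGraph {A : Type u} (R : A → A → A → Prop) (a b : A) : Part A :=
  ⟨∃ v, R a b v, fun h => h.choose⟩

theorem mem_partOfGraph {A : Type u} {R : A → A → A → Prop}
    (hR : ∀ {a b v v'}, R a b v → R a b v' → v = v') {a b v : A} :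
    v ∈ partOfGraph R a b ↔ R a b v :=
  ⟨fun ⟨h, e⟩ => e ▸ h.choose_spec, fun h => ⟨⟨v, h⟩, hR (Exists.choose_spec ⟨v, h⟩) h⟩⟩

namespace Tracking

variable {A : Type u} (T : Tracking A)

/-- The relative PCA `𝔸` presents the computable partial functions of `T`. -/
structure IsPresentedBy (𝔸 : RelPCA A) : Prop where
  global_of_mem : ∀ a ∈ 𝔸.sharp, T.Global a
  le_of_app : ∀ {I : Type u} {f g h : I → A}, (∀ i, h i ∈ 𝔸.app (f i) (g i)) →
    T.Le (fun i => T.pair (f i) (g i)) h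
  exists_index : ∀ {I : Type u} {f g : I → A}, T.Le f g →
    ∃ e ∈ 𝔸.sharp, ∀ i, g i ∈ 𝔸.app e (f i)

theorem IsPresentedBy.le_iff {T : Tracking A} {𝔸 : RelPCA A} (h : T.IsPresentedBy 𝔸) {I : Type u}
    {f g : I → A} : T.Le f g ↔ ∃ e ∈ 𝔸.sharp, ∀ i, g i ∈ 𝔸.app e (f i) :=
  ⟨h.exists_index, fun ⟨e, he, H⟩ => T.trans
    (T.le_pair ((h.global_of_mem e he).le f) (T.refl f)) (h.le_of_app (f := fun _ => e) H)⟩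

theorem exists_isPresentedBy_of_subsingleton [Subsingleton A] :
    ∃ 𝔸 : RelPCA A, T.IsPresentedBy 𝔸 := by
  have e : ∀ {I : Type u} (f : I → A), f = fun _ => T.unit := fun f =>
    funext fun i => Subsingleton.elim _ _
  refine ⟨⟨fun _ _ => .some T.unit, Set.univ, fun _ _ _ _ _ _ => trivial,
    ⟨T.unit, trivial, fun a b => ?_⟩, ⟨T.unit, trivial, fun a b => ⟨?_, fun c => ?_⟩⟩⟩,
    ⟨fun a _ => ?_, fun {I f g h} _ => ?_, fun {I f g} _ => ⟨T.unit, trivial, fun i => ?_⟩⟩⟩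
  · simp [partialApp, Subsingleton.elim a T.unit]
  · simp [partialApp]
  · simp [partialApp]
  · rw [Subsingleton.elim a T.unit]
    exact T.refl _
  · rw [e h]
    exact T.le_unit _
  · rw [e g]
    exact Part.mem_some _

/-- Application is `Star`, a restriction of `Dot`, so it is computable and single-valued. Two
distinct elements of `A` are needed to have distinct tags. -/
theorem exists_isPresentedBy_of_nontrivial [Nontrivial A] :
    ∃ 𝔸 : RelPCA A, T.IsPresentedBy 𝔸 := by
  -- The tags are codes of the two projections: they are global, and equal codes would force any two
  -- elements of `A` to be equal.
  obtain ⟨t, ht, ht'⟩ := T.exists_code (T.pair_fst (I := A × A) Prod.fst Prod.snd)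
  obtain ⟨f, hf, hf'⟩ := T.exists_code (T.pair_snd (I := A × A) Prod.fst Prod.snd)
  replace ht : T.Global t := ht
  replace hf : T.Global f := hf
  have htf : t ≠ f := by
    rintro rfl
    obtain ⟨x, y, hxy⟩ := exists_pair_ne A
    exact hxy (T.eval_unique (ht' (x, y)) (hf' (x, y)))
  -- The code carries a tag `l` next to its parameter `g i`; the function coded by `c` discards the
  -- tag.
  have code : ∀ {I : Type u} {g x h : I → A} (l : A),
      T.Le (fun i => T.pair (g i) (x i)) h → ∃ c, T.Global c ∧
        ∀ i, T.Dot (T.pair c (T.pair l (g i))) (x i) (h i) := by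
    intro I g x h l H
    have : T.Le (fun i => T.pair (T.pair l (g i)) (x i)) h :=
      T.trans (T.le_pair (T.trans (T.pair_fst _ _) (T.pair_snd (fun _ => l) g)) (T.pair_snd _ _)) H
    obtain ⟨c, hc, hc'⟩ := T.exists_code this
    exact ⟨c, hc, fun i => ⟨_, _, rfl, hc' i⟩⟩
  -- substitution
  let W := {w : A × A × A × A × A × A // T.Dot w.1 w.2.2.1 w.2.2.2.1 ∧
    T.Dot w.2.1 w.2.2.1 w.2.2.2.2.1 ∧ T.Dot w.2.2.2.1 w.2.2.2.2.1 w.2.2.2.2.2}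
  obtain ⟨σ, hσ, hσ'⟩ : ∃ c, T.Global c ∧ ∀ w : W, T.Dot
      (T.pair c (T.pair f (T.pair w.1.1 w.1.2.1))) w.1.2.2.1 w.1.2.2.2.2.2 := by
    refine code f ?_
    have hxy := T.pair_fst (I := W) (fun w => T.pair w.1.1 w.1.2.1) (fun w => w.1.2.2.1)
    have hz := T.pair_snd (I := W) (fun w => T.pair w.1.1 w.1.2.1) (fun w => w.1.2.2.1)
    have hp := T.trans (T.le_pair (T.trans hxy (T.pair_fst _ _)) hz)
      (T.le_of_dot fun w : W => w.2.1)
    have hq := T.trans (T.le_pair (T.trans hxy (T.pair_snd _ _)) hz)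
      (T.le_of_dot fun w : W => w.2.2.1)
    exact T.trans (T.le_pair hp hq) (T.le_of_dot fun w : W => w.2.2.2)
  -- Only substitution codes carry the tag `f`; every code built below carries `t`, so that `Star`
  -- agrees with `Dot` on it.
  let sub : A → A → A := fun x y => T.pair σ (T.pair f (T.pair x y))
  have sub_inj : ∀ {x y x' y'}, sub x y = sub x' y' → x = x' ∧ y = y' := fun h =>
    T.pair_injective (T.pair_injective (T.pair_injective h).2).2
  have star_dot : ∀ {a b r}, T.Star sub a b r → T.Dot a b r :=
    Star.to_dot T fun {x y z p q r} h₁ h₂ h₃ => hσ' ⟨(x, y, z, p, q, r), h₁, h₂, h₃⟩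
  have ne_sub : ∀ c a x y, T.pair c (T.pair t a) ≠ sub x y := fun c a x y h =>
    htf (T.pair_injective (T.pair_injective h).2).1
  have mem {a b v} : v ∈ partOfGraph (T.Star sub) a b ↔ T.Star sub a b v :=
    mem_partOfGraph (R := T.Star sub) (fun h h' => T.dot_unique (star_dot h) (star_dot h'))
      (a := a) (b := b)
  have eq_some {c a b v} (h : T.Dot (T.pair c (T.pair t a)) b v) :
      partOfGraph (T.Star sub) (T.pair c (T.pair t a)) b = .some v :=
    Part.eq_some_iff.2 (mem.2 (.dot (ne_sub c a) h))
  have code₁ : ∀ {I : Type u} {g h : I → A}, T.Le g h →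
      ∃ c, T.Global c ∧ ∀ i, T.Dot (T.pair c (T.pair t t)) (g i) (h i) := fun {I g h} H =>
    code (g := fun _ => t) t (T.trans (T.pair_snd _ _) H)
  -- Currying: `k` sends `a` to the code `k'` with parameter `a`. Likewise `s` sends `a` to `s'`
  -- with parameter `a`, which sends `b` to `sub a b`.
  obtain ⟨k', hk', k'_dot⟩ := code t (T.pair_fst (I := A × A) Prod.fst Prod.snd)
  obtain ⟨k, hk, k_dot⟩ := code₁ (T.le_pair (hk'.le (id : A → A)) (T.le_pair (ht.le id) (T.refl _)))
  obtain ⟨s', hs', s'_dot⟩ := code (I := A × A) (g := Prod.fst) (x := Prod.snd) t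
    (T.le_pair (hσ.le _) (T.le_pair (hf.le _) (T.refl _)))
  obtain ⟨s, hs, s_dot⟩ := code₁ (T.le_pair (hs'.le (id : A → A)) (T.le_pair (ht.le id) (T.refl _)))
  simp only [id] at k_dot s_dot
  refine ⟨⟨partOfGraph (T.Star sub), {c | T.Global c}, fun a ha b hb c hc => ?_,
    ⟨_, hk.pair (ht.pair ht), fun a b => ?_⟩, ⟨_, hs.pair (ht.pair ht), fun a b => ?_⟩⟩,
    ⟨fun _ h => h, fun H => T.le_of_dot fun i => star_dot (mem.1 (H i)), fun H => ?_⟩⟩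
  · exact T.trans (Global.pair (T := T) ha hb) (T.le_of_dot fun _ => star_dot (mem.1 hc))
  · simp only [partialApp, Part.bind_some]
    rw [eq_some (k_dot a), Part.bind_some]
    exact eq_some (k'_dot (a, b))
  · simp only [partialApp, Part.bind_some]
    rw [eq_some (s_dot a), Part.bind_some]
    rw [eq_some (s'_dot (a, b))]
    refine ⟨trivial, fun c => Part.ext fun r => ?_⟩
    simp only [Part.bind_some, Part.mem_bind_iff, mem]
    exact T.star_subst_iff sub_inj
  · obtain ⟨c, hc, hc'⟩ := code₁ H
    exact ⟨_, hc.pair (ht.pair ht), fun i => mem.2 (.dot (ne_sub c t) (hc' i))⟩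

theorem exists_isPresentedBy : ∃ 𝔸 : RelPCA A, T.IsPresentedBy 𝔸 := by
  rcases subsingleton_or_nontrivial A with _ | _
  · exact T.exists_isPresentedBy_of_subsingleton
  · exact T.exists_isPresentedBy_of_nontrivial

end Tracking

-- Computability from a discrete generic prime predicate

theorem isGLB_pair_iff {α : Type*} [Preorder α] {a b m : α} :
    IsGLB {a, b} m ↔ (m ≤ a ∧ m ≤ b) ∧ ∀ c, c ≤ a → c ≤ b → c ≤ m := by
  simp [IsGLB, IsGreatest, lowerBounds, upperBounds]

theorem IsGLB.pair_congr {α : Type*} [Preorder α] {a b m a' b' m' : α} (h : IsGLB {a, b} m)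
    (ha : AntisymmRel (· ≤ ·) a a') (hb : AntisymmRel (· ≤ ·) b b')
    (hm : AntisymmRel (· ≤ ·) m m') : IsGLB {a', b'} m' := by
  rw [isGLB_pair_iff] at h ⊢
  exact ⟨⟨hm.2.trans (h.1.1.trans ha.1), hm.2.trans (h.1.2.trans hb.1)⟩,
    fun c hca hcb => (h.2 c (hca.trans ha.2) (hcb.trans hb.2)).trans hm.1⟩

namespace IndexedPreorder

/-- Two indexed preorders are equivalent if they are related by a correspondence that is total on
both sides, stable under reindexing, and compatible with the orders. -/
theorem isEquivalent_of_correspondence {H : IndexedPreorder.{u, v}} {K : IndexedPreorder.{u, w}}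
    (R : ∀ {I : Type u}, H.Pred I → K.Pred I → Prop)
    (total_left : ∀ {I : Type u} (φ : H.Pred I), ∃ ψ : K.Pred I, R φ ψ)
    (total_right : ∀ {I : Type u} (ψ : K.Pred I), ∃ φ : H.Pred I, R φ ψ)
    (le_iff : ∀ {I : Type u} {φ φ' : H.Pred I} {ψ ψ' : K.Pred I}, R φ ψ → R φ' ψ' →
      (φ ≤ φ' ↔ ψ ≤ ψ'))
    (reindex : ∀ {I J : Type u} (f : J → I) {φ : H.Pred I} {ψ : K.Pred I}, R φ ψ →
      R (H.reindex f φ) (K.reindex f ψ)) : H.IsEquivalent K := by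
  choose F hF using @total_left
  choose G hG using @total_right
  have iso_left : ∀ {I : Type u} {φ φ' : H.Pred I} {ψ : K.Pred I}, R φ ψ → R φ' ψ →
      H.Iso φ φ' := fun h h' => ⟨(le_iff h h').2 le_rfl, (le_iff h' h).2 le_rfl⟩
  have iso_right : ∀ {I : Type u} {φ : H.Pred I} {ψ ψ' : K.Pred I}, R φ ψ → R φ ψ' →
      K.Iso ψ ψ' := fun h h' => ⟨(le_iff h h').1 le_rfl, (le_iff h' h).1 le_rfl⟩
  exact ⟨⟨fun I => ⟨F, fun _ _ h => (le_iff (hF _) (hF _)).1 h⟩,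
      fun f φ => iso_right (hF _) (reindex f (hF φ))⟩,
    ⟨fun I => ⟨G, fun _ _ h => (le_iff (hG _) (hG _)).2 h⟩,
      fun f ψ => iso_left (hG _) (reindex f (hG ψ))⟩,
    fun I φ => iso_left (hG _) (hF φ), fun I ψ => iso_right (hF _) (hG ψ)⟩

variable {P : IndexedPreorder.{u, v}}

theorem IsExists.congr {I J : Type u} {f : J → I} {φ φ' : P.Pred J} {χ : P.Pred I}
    (h : P.IsExists f φ χ) (e : P.Iso φ φ') : P.IsExists f φ' χ := fun ψ =>
  (h ψ).trans ⟨e.2.trans, e.1.trans⟩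

theorem isPullbackSquare_subtype {I J K : Type u} (f : J → I) (g : K → I) :
    IsPullbackSquare (fun l : {l : J × K // f l.1 = g l.2} => l.1.1) (fun l => l.1.2) f g :=
  ⟨fun l => l.2, fun j k h => ⟨⟨(j, k), h⟩, ⟨rfl, rfl⟩, fun _ h =>
    Subtype.ext (Prod.ext h.1 h.2)⟩⟩

/-- Any lower bound is `∃_f π` with `π` prime, so comparing it with `m` amounts to comparing `π`
with `f^* m`, a meet among primes by stability. -/
theorem prim_isGLB (hE : P.HasEnoughExPrimes) (hM : P.prim.HasFiniteMeets) {I : Type u}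
    {φ ψ m : P.prim.Pred I} (h : IsGLB {φ, ψ} m) : IsGLB {φ.1, ψ.1} m.1 := by
  refine isGLB_pair_iff.2 ⟨(isGLB_pair_iff.1 h).1, fun ζ hφ hψ => ?_⟩
  obtain ⟨J, f, π, hπ, hex⟩ := hE I ζ
  exact (hex m.1).2 ((isGLB_pair_iff.1 (hM.reindex_inf f φ ψ m h)).2 ⟨π, hπ⟩
    ((hex _).1 hφ) ((hex _).1 hψ))

/-- Discreteness is applied to the surjection of `I` onto the range of `f`, with `δ` restricted to
that range. -/
theorem IsDiscrete.functional {A I : Type u} {δ : P.Pred A} (hδ : P.IsDiscrete δ) {f g : I → A}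
    (h : P.reindex f δ ≤ P.reindex g δ) {i j : I} (hij : f i = f j) : g i = g j := by
  obtain ⟨g', rfl⟩ := hδ (Set.range f) I (Set.rangeFactorization f) g
    (P.reindex Subtype.val δ) Set.rangeFactorization_surjective
    ((P.reindex_comp Subtype.val (Set.rangeFactorization f) δ).2.trans h)
  exact congrArg g' (Subtype.ext hij)

/-- The meet of the two projections of `δ` on `A × A` is classified by a map to `A`; stability of
meets gives all other cases. -/
theorem exists_pairing (hM : P.HasFiniteMeets) {A : Type u} {δ : P.Pred A} (hδ : P.IsGeneric δ) :
    ∃ p : A → A → A, ∀ {I : Type u} (f g : I → A),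
      IsGLB {P.reindex f δ, P.reindex g δ} (P.reindex (fun i => p (f i) (g i)) δ) := by
  obtain ⟨m, hm⟩ := hM.exists_inf (A × A) (P.reindex Prod.fst δ) (P.reindex Prod.snd δ)
  obtain ⟨p, hp⟩ := hδ _ m
  refine ⟨fun a b => p (a, b), fun {I} f g => ?_⟩
  let k : I → A × A := fun i => (f i, g i)
  have hk : P.Iso (P.reindex k (P.reindex p δ)) (P.reindex k m) :=
    ⟨(P.reindex k).monotone hp.1, (P.reindex k).monotone hp.2⟩
  exact (hM.reindex_inf k _ _ m hm).pair_congr (P.reindex_comp Prod.fst k δ).symm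
    (P.reindex_comp Prod.snd k δ).symm (hk.symm.trans (P.reindex_comp p k δ).symm)

theorem exists_unit (hM : P.HasFiniteMeets) {A : Type u} {δ : P.Pred A} (hδ : P.IsGeneric δ) :
    ∃ t : A, ∀ I : Type u, IsTop (P.reindex (fun _ : I => t) δ) := by
  obtain ⟨m, hm⟩ := hM.exists_top PUnit
  obtain ⟨t, ht⟩ := hδ _ m
  refine ⟨t ⟨⟩, fun I φ => ?_⟩
  exact (hM.reindex_top (fun _ : I => PUnit.unit) m hm φ).trans
    (((P.reindex _).monotone ht.2).trans (P.reindex_comp t (fun _ : I => PUnit.unit) δ).2)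

/-- Codes are the values of `q`, where `∃_w (q^* δ)` is the predicate "R is tracked" on subsets R of
`A × A`; a code evaluates along any relation `w z` that it covers. -/
theorem exists_evaluation (hP : P.IsTripos) (hE : P.HasEnoughExPrimes) {A : Type u}
    {δ : P.prim.Pred A} (hδ : P.prim.IsGeneric δ) {p : A → A → A}
    (hp : ∀ {I : Type u} (f g : I → A),
      IsGLB {P.reindex f δ.1, P.reindex g δ.1} (P.reindex (fun i => p (f i) (g i)) δ.1))
    (t : A) : ∃ Eval : A → A → A → Prop,
      (∀ {I : Type u} {f g h : I → A}, (∀ i, Eval (f i) (g i) (h i)) →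
        P.reindex (fun i => p (f i) (g i)) δ.1 ≤ P.reindex h δ.1) ∧
      ∀ {I : Type u} {f g : I → A}, P.reindex f δ.1 ≤ P.reindex g δ.1 →
        ∃ c, P.reindex (fun _ : PUnit => t) δ.1 ≤ P.reindex (fun _ : PUnit => c) δ.1 ∧
          ∀ i, Eval c (f i) (g i) := by
  let Y := {y : Set (A × A) × A × A // y.2 ∈ y.1}
  let b : Y → A := fun y => y.1.2.1
  let v : Y → A := fun y => y.1.2.2
  let pr : Y → Set (A × A) := fun y => y.1.1
  obtain ⟨α, hα⟩ := hP.hasImplication.exists_imp Y (P.reindex b δ.1) (P.reindex v δ.1)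
  obtain ⟨Θ, hΘ⟩ := hP.hasUniversalQuantification.exists_forall pr α
  obtain ⟨Z, w, π, hπ, hex⟩ := hE _ Θ
  obtain ⟨q, hq⟩ := hδ Z ⟨π, hπ⟩
  replace hex : P.IsExists w (P.reindex q δ.1) Θ := hex.congr (AntisymmRel.symm hq)
  refine ⟨fun x y r => ∃ z, q z = x ∧ (y, r) ∈ w z, ?_, ?_⟩
  · intro I f g h H
    choose z hz hm using H
    obtain rfl : q ∘ z = f := funext hz
    let κ : I → Y := fun i => ⟨(w (z i), g i, h i), hm i⟩
    have key : P.reindex (q ∘ z) δ.1 ≤ P.reindex κ α :=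
      calc P.reindex (q ∘ z) δ.1 ≤ P.reindex z (P.reindex q δ.1) := (P.reindex_comp q z _).1
        _ ≤ P.reindex z (P.reindex w Θ) := (P.reindex z).monotone ((hex Θ).1 le_rfl)
        _ ≤ P.reindex (w ∘ z) Θ := (P.reindex_comp w z Θ).2
        _ ≤ P.reindex κ (P.reindex pr Θ) := (P.reindex_comp pr κ Θ).1
        _ ≤ P.reindex κ α := (P.reindex κ).monotone ((hΘ Θ).1 le_rfl)
    have hglb := (hp (q ∘ z) g).pair_congr .rfl (P.reindex_comp b κ δ.1) .rfl
    exact ((hP.hasImplication.reindex_imp κ _ _ α hα _ _ hglb).2 key).trans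
      (P.reindex_comp v κ δ.1).2
  · intro I f g H
    let x : PUnit.{u + 1} → Set (A × A) := fun _ => Set.range fun i => (f i, g i)
    -- The set of all pairs `(f i, g i)` is tracked, by the hypothesis `f^* δ ≤ g^* δ`.
    have top_le : P.reindex (fun _ : PUnit => t) δ.1 ≤ P.reindex x Θ := by
      have sq := isPullbackSquare_subtype x pr
      rw [hP.hasUniversalQuantification.beckChevalley _ _ x pr sq α Θ hΘ]
      let κ : {l : PUnit.{u + 1} × Y // x l.1 = pr l.2} → Y := fun l => l.1.2
      obtain ⟨m, hm⟩ := hP.hasFiniteMeets.exists_inf _ (P.reindex (fun l => l.1.1)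
        (P.reindex (fun _ : PUnit => t) δ.1)) (P.reindex κ (P.reindex b δ.1))
      rw [← hP.hasImplication.reindex_imp κ _ _ α hα _ m hm]
      have hl : ∀ l, ∃ i, (f i, g i) = (κ l).1.2 := by
        intro l
        have : (κ l).1.2 ∈ x l.1.1 := by rw [l.2]; exact l.1.2.2
        exact this
      choose s hs using hl
      have hb : b ∘ κ = f ∘ s := funext fun l => (congrArg Prod.fst (hs l)).symm
      have hv : v ∘ κ = g ∘ s := funext fun l => (congrArg Prod.snd (hs l)).symm
      calc m ≤ P.reindex κ (P.reindex b δ.1) := (isGLB_pair_iff.1 hm).1.2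
        _ ≤ P.reindex (b ∘ κ) δ.1 := (P.reindex_comp b κ δ.1).2
        _ = P.reindex (f ∘ s) δ.1 := by rw [hb]
        _ ≤ P.reindex s (P.reindex f δ.1) := (P.reindex_comp f s δ.1).1
        _ ≤ P.reindex s (P.reindex g δ.1) := (P.reindex s).monotone H
        _ ≤ P.reindex (g ∘ s) δ.1 := (P.reindex_comp g s δ.1).2
        _ = P.reindex (v ∘ κ) δ.1 := by rw [hv]
        _ ≤ P.reindex κ (P.reindex v δ.1) := (P.reindex_comp v κ δ.1).1
    have hex' := hP.hasExistentialQuantification.beckChevalley _ _ x w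
      (isPullbackSquare_subtype x w) _ Θ hex
    -- Primality picks one `z` with `w z` equal to this set and `q z` below `t^* δ`'s truth value,
    -- in the sense that `t^* δ` entails `(q z)^* δ`.
    obtain ⟨s, -, hs⟩ := δ.2 _ _ _ _ _ _ hex' top_le
    refine ⟨q (s ⟨⟩).1.2, ?_, fun i => ⟨_, rfl, ?_⟩⟩
    · let κ : {l : PUnit.{u + 1} × Z // x l.1 = w l.2} → Z := fun l => l.1.2
      exact hs.trans (((P.reindex s).monotone (P.reindex_comp q κ δ.1).2).trans
        (P.reindex_comp (q ∘ κ) s δ.1).2)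
    · rw [← (s ⟨⟩).2]
      exact ⟨i, rfl⟩

/-- In a tripos with enough `∃`-primes, whose `∃`-primes have finite meets, a discrete generic
`∃`-prime predicate `δ` on `A` defines a notion of computability on `A`. -/
theorem exists_tracking (hP : P.IsTripos) (hE : P.HasEnoughExPrimes)
    (hM : P.prim.HasFiniteMeets) {A : Type u} {δ : P.prim.Pred A} (hδ : P.prim.IsGeneric δ)
    (hδ' : P.prim.IsDiscrete δ) :
    ∃ T : Tracking A, ∀ {I : Type u} (f g : I → A),
      T.Le f g ↔ P.reindex f δ.1 ≤ P.reindex g δ.1 := by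
  obtain ⟨p, hp⟩ := exists_pairing hM hδ
  obtain ⟨t, ht⟩ := exists_unit hM hδ
  have hp' : ∀ {I : Type u} (f g : I → A), IsGLB {P.reindex f δ.1, P.reindex g δ.1}
    (P.reindex (fun i => p (f i) (g i)) δ.1) := fun f g => prim_isGLB hE hM (hp f g)
  obtain ⟨Eval, h₁, h₂⟩ := exists_evaluation hP hE hδ hp' t
  exact ⟨{
    Le f g := P.reindex f δ.1 ≤ P.reindex g δ.1
    refl _ := le_rfl
    trans := le_trans
    comp {_ _ f g} h H := (P.reindex_comp f h δ.1).1.trans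
      (((P.reindex h).monotone H).trans (P.reindex_comp g h δ.1).2)
    functional H _ _ e := hδ'.functional H e
    pair := p
    pair_fst f g := (isGLB_pair_iff.1 (hp' f g)).1.1
    pair_snd f g := (isGLB_pair_iff.1 (hp' f g)).1.2
    le_pair H H' := (isGLB_pair_iff.1 (hp' _ _)).2 _ H H'
    unit := t
    le_unit f := ht _ (P.prim.reindex f δ)
    Eval := Eval
    le_of_eval := h₁
    exists_code := h₂ }, fun _ _ => Iff.rfl⟩

-- Predicates as families of subsets

/-- `φ` is the predicate `∃ a ∈ S i, δ a`. -/
def Represents {A I : Type u} (δ : P.Pred A) (φ : P.Pred I) (S : I → Set A) : Prop :=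
  ∃ (J : Type u) (p : J → I) (f : J → A), P.IsExists p (P.reindex f δ) φ ∧
    ∀ i a, a ∈ S i ↔ ∃ j, p j = i ∧ f j = a

/-- By Beck–Chevalley, `p^* ψ` is an existential quantification along the pullback of `q`. Primality
of `δ` yields a section of that pullback, that is, a map `J → K` over `I`. -/
theorem le_iff_exists_section (hX : P.HasExistentialQuantification) {A : Type u} {δ : P.Pred A}
    (hδ : P.IsExPrime δ) {I J K : Type u} {p : J → I} {f : J → A} {q : K → I} {g : K → A}
    {φ ψ : P.Pred I} (hφ : P.IsExists p (P.reindex f δ) φ) (hψ : P.IsExists q (P.reindex g δ) ψ) :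
    φ ≤ ψ ↔ ∃ s : J → K, q ∘ s = p ∧ P.reindex f δ ≤ P.reindex (g ∘ s) δ := by
  rw [hφ ψ]
  constructor
  · intro h
    have hex := hX.beckChevalley _ _ p q (isPullbackSquare_subtype p q) _ ψ hψ
    obtain ⟨s, hs, hs'⟩ := hδ _ _ _ _ _ _ hex h
    let κ : {l : J × K // p l.1 = q l.2} → K := fun l => l.1.2
    refine ⟨κ ∘ s, funext fun j => ?_, hs'.trans (((P.reindex s).monotone
      (P.reindex_comp g κ δ).2).trans (P.reindex_comp (g ∘ κ) s δ).2)⟩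
    exact (s j).2.symm.trans (congrArg p (congrFun hs j))
  · rintro ⟨s, rfl, h⟩
    calc P.reindex f δ ≤ P.reindex (g ∘ s) δ := h
      _ ≤ P.reindex s (P.reindex g δ) := (P.reindex_comp g s δ).1
      _ ≤ P.reindex s (P.reindex q ψ) := (P.reindex s).monotone ((hψ ψ).1 le_rfl)
      _ ≤ P.reindex (q ∘ s) ψ := (P.reindex_comp q s ψ).2

theorem Represents.reindex (hX : P.HasExistentialQuantification) {A I J : Type u} {δ : P.Pred A}
    {φ : P.Pred I} {S : I → Set A} (h : Represents δ φ S) (f : J → I) :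
    Represents δ (P.reindex f φ) (S ∘ f) := by
  obtain ⟨K, p, g, hex, hS⟩ := h
  refine ⟨_, _, _, (hX.beckChevalley _ _ f p (isPullbackSquare_subtype f p) _ φ hex).congr
    (P.reindex_comp g _ δ).symm, fun j a => (hS _ a).trans ⟨?_, ?_⟩⟩
  · rintro ⟨k, hk, rfl⟩
    exact ⟨⟨(j, k), hk.symm⟩, rfl, rfl⟩
  · rintro ⟨l, rfl, rfl⟩
    exact ⟨_, l.2.symm, rfl⟩

theorem exists_isEquivalent_realizabilityTripos (hP : P.IsTripos) (hE : P.HasEnoughExPrimes)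
    (hM : P.prim.HasFiniteMeets) {A : Type u} {δ : P.prim.Pred A} (hδ : P.prim.IsGeneric δ)
    (hδ' : P.prim.IsDiscrete δ) : ∃ 𝔸 : RelPCA A, P.IsEquivalent 𝔸.realizabilityTripos := by
  obtain ⟨T, hT⟩ := exists_tracking hP hE hM hδ hδ'
  obtain ⟨𝔸, h𝔸⟩ := T.exists_isPresentedBy
  have hX := hP.hasExistentialQuantification
  refine ⟨𝔸, isEquivalent_of_correspondence (K := 𝔸.realizabilityTripos)
    (fun φ S => Represents δ.1 φ S) ?_ ?_ ?_ fun f _ _ h => h.reindex hX f⟩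
  · intro I φ
    obtain ⟨J, p, π, hπ, hex⟩ := hE I φ
    obtain ⟨f, hf⟩ := hδ J ⟨π, hπ⟩
    exact ⟨fun i => {a | ∃ j, p j = i ∧ f j = a}, J, p, f, hex.congr (AntisymmRel.symm hf),
      fun _ _ => Iff.rfl⟩
  · intro I S
    let J := {x : I × A // x.2 ∈ (show I → Set A from S) x.1}
    obtain ⟨φ, hφ⟩ := hX.exists_exists (fun x : J => x.1.1) (P.reindex (fun x => x.1.2) δ.1)
    refine ⟨φ, J, _, _, hφ, fun i a => ⟨fun h => ⟨⟨(i, a), h⟩, rfl, rfl⟩, ?_⟩⟩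
    rintro ⟨x, rfl, rfl⟩
    exact x.2
  · rintro I φ ψ S S' ⟨J, p, f, hφ, hS⟩ ⟨K, q, g, hψ, hS'⟩
    rw [le_iff_exists_section hX δ.2 hφ hψ]
    simp only [← hT, h𝔸.le_iff]
    constructor
    · rintro ⟨s, rfl, e, he, H⟩
      refine ⟨e, he, fun i a ha => ?_⟩
      obtain ⟨j, rfl, rfl⟩ := (hS i a).1 ha
      exact ⟨_, H j, (hS' _ _).2 ⟨s j, rfl, rfl⟩⟩
    -- The realizer moves `f j` to an element of `S' (p j)`; choosing an index `k` for it defines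
    -- the map over `I`.
    · rintro ⟨e, he, H⟩
      have : ∀ j, ∃ k, q k = p j ∧ g k ∈ 𝔸.app e (f j) := fun j => by
        obtain ⟨b, hb, hb'⟩ := H _ _ ((hS _ _).2 ⟨j, rfl, rfl⟩)
        obtain ⟨k, hk, rfl⟩ := (hS' _ _).1 hb'
        exact ⟨k, hk, hb⟩
      choose s hs hs' using this
      exact ⟨s, funext hs, e, he, hs'⟩

end IndexedPreorder

-- Invariance under equivalence

namespace IndexedPreorder

/-- Mutually inverse (up to isomorphism) indexed monotone maps. -/
structure Equivalence (H : IndexedPreorder.{u, v}) (K : IndexedPreorder.{u, w}) where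
  hom : Hom H K
  inv : Hom K H
  inv_hom : ∀ (I : Type u) (φ : H.Pred I), H.Iso (inv.app I (hom.app I φ)) φ
  hom_inv : ∀ (I : Type u) (ψ : K.Pred I), K.Iso (hom.app I (inv.app I ψ)) ψ

namespace Equivalence

variable {H : IndexedPreorder.{u, v}} {K : IndexedPreorder.{u, w}}

/-- The inverse of an equivalence. -/
def symm (E : Equivalence H K) : Equivalence K H := ⟨E.inv, E.hom, E.hom_inv, E.inv_hom⟩

variable (E : Equivalence H K) {I J A : Type u}

/-- With `le_hom_iff`, this makes the inverse a fiberwise adjoint on both sides, so that quantifiers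
and meets transfer. -/
theorem hom_le_iff {φ : H.Pred I} {ψ : K.Pred I} : E.hom.app I φ ≤ ψ ↔ φ ≤ E.inv.app I ψ :=
  ⟨fun h => (E.inv_hom I φ).2.trans ((E.inv.app I).monotone h),
    fun h => ((E.hom.app I).monotone h).trans (E.hom_inv I ψ).1⟩

theorem le_hom_iff {φ : H.Pred I} {ψ : K.Pred I} : ψ ≤ E.hom.app I φ ↔ E.inv.app I ψ ≤ φ :=
  E.symm.hom_le_iff.symm

theorem hom_le_hom_iff {φ ψ : H.Pred I} : E.hom.app I φ ≤ E.hom.app I ψ ↔ φ ≤ ψ :=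
  E.hom_le_iff.trans ⟨fun h => h.trans (E.inv_hom I ψ).1, fun h => h.trans (E.inv_hom I ψ).2⟩

theorem isExists {f : J → I} {φ : H.Pred J} {χ : H.Pred I} (h : H.IsExists f φ χ) :
    K.IsExists f (E.hom.app J φ) (E.hom.app I χ) := fun ψ => by
  rw [E.hom_le_iff, h, E.hom_le_iff]
  exact ⟨fun h => h.trans (E.inv.naturality f ψ).2, fun h => h.trans (E.inv.naturality f ψ).1⟩

theorem isExPrime {π : H.Pred I} (hπ : H.IsExPrime π) : K.IsExPrime (E.hom.app I π) := by
  intro J L f g φ χ hχ h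
  obtain ⟨s, hs, hs'⟩ := hπ J L f g _ _ (E.symm.isExists hχ)
    (E.hom_le_iff.1 ((E.hom.naturality f π).1.trans h))
  refine ⟨s, hs, (E.hom.naturality f π).2.trans (E.hom_le_iff.2 (hs'.trans ?_))⟩
  exact (E.inv.naturality s φ).2

/-- An equivalence restricts to the `∃`-prime predicates. -/
def prim : Equivalence H.prim K.prim where
  hom := ⟨fun I => ⟨fun π => ⟨E.hom.app I π.1, E.isExPrime π.2⟩,
    fun _ _ h => (E.hom.app I).monotone h⟩, fun f π => E.hom.naturality f π.1⟩
  inv := ⟨fun I => ⟨fun π => ⟨E.inv.app I π.1, E.symm.isExPrime π.2⟩,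
    fun _ _ h => (E.inv.app I).monotone h⟩, fun f π => E.inv.naturality f π.1⟩
  inv_hom I π := E.inv_hom I π.1
  hom_inv I π := E.hom_inv I π.1

theorem hasEnoughExPrimes (E : Equivalence H K) (h : H.HasEnoughExPrimes) :
    K.HasEnoughExPrimes := by
  intro I ψ
  obtain ⟨J, f, π, hπ, hex⟩ := h I (E.inv.app I ψ)
  refine ⟨J, f, _, E.isExPrime hπ, fun ζ => ?_⟩
  rw [← E.isExists hex ζ]
  exact ⟨(E.hom_inv I ψ).1.trans, (E.hom_inv I ψ).2.trans⟩

theorem isTop {t : H.Pred I} (ht : IsTop t) : IsTop (E.hom.app I t) := fun _ =>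
  E.le_hom_iff.2 (ht _)

theorem isGLB {φ ψ m : H.Pred I} (h : IsGLB {φ, ψ} m) :
    IsGLB {E.hom.app I φ, E.hom.app I ψ} (E.hom.app I m) := by
  rw [isGLB_pair_iff] at h ⊢
  simp only [E.hom_le_hom_iff, E.le_hom_iff]
  exact ⟨h.1, fun _ => h.2 _⟩

theorem hasFiniteMeets (E : Equivalence H K) (h : H.HasFiniteMeets) : K.HasFiniteMeets where
  exists_top I := (h.exists_top I).imp' _ fun _ => E.isTop
  exists_inf I φ ψ := by
    obtain ⟨m, hm⟩ := h.exists_inf I (E.inv.app I φ) (E.inv.app I ψ)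
    exact ⟨_, (E.isGLB hm).pair_congr (E.hom_inv I φ) (E.hom_inv I ψ) .rfl⟩
  reindex_top f t ht φ := by
    have := E.isTop (h.reindex_top f _ (E.symm.isTop ht)) φ
    exact (this.trans ((E.hom.app _).monotone (E.inv.naturality f t).2)).trans
      (E.hom_inv _ _).1
  reindex_inf {I J} f φ ψ m hm := by
    have e : ∀ ζ : K.Pred I, K.Iso (E.hom.app J (H.reindex f (E.inv.app I ζ)))
        (K.reindex f ζ) := fun ζ =>
      ⟨((E.hom.app _).monotone (E.inv.naturality f ζ).2).trans (E.hom_inv _ _).1,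
        (E.hom_inv _ _).2.trans ((E.hom.app _).monotone (E.inv.naturality f ζ).1)⟩
    exact (E.isGLB (h.reindex_inf f _ _ _ (E.symm.isGLB hm))).pair_congr (e _) (e _) (e _)

theorem isGeneric {δ : H.Pred A} (h : H.IsGeneric δ) : K.IsGeneric (E.hom.app A δ) := by
  intro B φ
  obtain ⟨f, hf⟩ := h B (E.inv.app B φ)
  exact ⟨f, (E.hom.naturality f δ).2.trans (E.hom_le_iff.2 hf.1),
    (E.le_hom_iff.2 hf.2).trans (E.hom.naturality f δ).1⟩

theorem isDiscrete {δ : H.Pred A} (h : H.IsDiscrete δ) : K.IsDiscrete (E.hom.app A δ) := by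
  intro J L e f φ he hle
  refine h J L e f (E.inv.app J φ) he ((E.inv.naturality e φ).2.trans ?_)
  exact E.le_hom_iff.1 (hle.trans (E.hom.naturality f δ).2)

end Equivalence

end IndexedPreorder

-- Combinators and pairing in a relative PCA

namespace RelPCA

variable {A : Type u} (𝔸 : RelPCA A)

theorem exists_constants : ∃ K : A → A, (∀ a b, a ∈ 𝔸.app (K a) b) ∧
    (∀ a ∈ 𝔸.sharp, K a ∈ 𝔸.sharp) ∧ ∃ k ∈ 𝔸.sharp, ∀ a, K a ∈ 𝔸.app k a := by
  obtain ⟨k, hk, h⟩ := 𝔸.exists_k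
  simp only [partialApp, Part.bind_some] at h
  have h' : ∀ a, ∃ x, x ∈ 𝔸.app k a ∧ ∀ b, a ∈ 𝔸.app x b := fun a => by
    have ha : a ∈ (𝔸.app k a).bind fun x => 𝔸.app x a := by rw [h]; exact Part.mem_some a
    obtain ⟨x, hx, -⟩ := Part.mem_bind_iff.1 ha
    refine ⟨x, hx, fun b => ?_⟩
    have := h a b
    rw [Part.eq_some_iff.2 hx, Part.bind_some] at this
    rw [this]
    exact Part.mem_some a
  choose K hK hK' using h'
  exact ⟨K, hK', fun a ha => 𝔸.app_mem_sharp k hk a ha _ (hK a), k, hk, hK⟩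

theorem exists_substitutions : ∃ S : A → A → A,
    (∀ x y z p q r, p ∈ 𝔸.app x z → q ∈ 𝔸.app y z → r ∈ 𝔸.app p q → r ∈ 𝔸.app (S x y) z) ∧
    (∀ x ∈ 𝔸.sharp, ∀ y ∈ 𝔸.sharp, S x y ∈ 𝔸.sharp) ∧
    ∃ s ∈ 𝔸.sharp, ∃ S' : A → A, (∀ x, S' x ∈ 𝔸.app s x) ∧ ∀ x y, S x y ∈ 𝔸.app (S' x) y := by
  obtain ⟨s, hs, h⟩ := 𝔸.exists_s
  simp only [partialApp, Part.bind_some] at h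
  have h₁ : ∀ x, ∃ x', x' ∈ 𝔸.app s x := fun x => by
    obtain ⟨e, he⟩ := Part.dom_iff_mem.1 (h x x).1
    obtain ⟨x', hx', -⟩ := Part.mem_bind_iff.1 he
    exact ⟨x', hx'⟩
  choose S' hS' using h₁
  simp only [fun x => Part.eq_some_iff.2 (hS' x), Part.bind_some] at h
  choose S hS using fun x y => Part.dom_iff_mem.1 (h x y).1
  simp only [fun x y => Part.eq_some_iff.2 (hS x y), Part.bind_some] at h
  refine ⟨S, fun x y z p q r hp hq hr => ?_, fun x hx y hy => ?_, s, hs, S', hS', hS⟩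
  · rw [(h x y).2, Part.eq_some_iff.2 hp, Part.bind_some, Part.eq_some_iff.2 hq, Part.bind_some]
    exact hr
  · exact 𝔸.app_mem_sharp _ (𝔸.app_mem_sharp s hs x hx _ (hS' x)) y hy _ (hS x y)

/-- Relative PCAs have pairing, such that pairs of computable functions are computable. -/
theorem exists_pairing : ∃ p : A → A → A,
    (∃ e ∈ 𝔸.sharp, ∀ a b, a ∈ 𝔸.app e (p a b)) ∧ (∃ e ∈ 𝔸.sharp, ∀ a b, b ∈ 𝔸.app e (p a b)) ∧
    ∀ f ∈ 𝔸.sharp, ∀ g ∈ 𝔸.sharp, ∃ e ∈ 𝔸.sharp, ∀ x a b, a ∈ 𝔸.app f x → b ∈ 𝔸.app g x →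
      p a b ∈ 𝔸.app e x := by
  obtain ⟨K, hK, hK', k, hk, hkK⟩ := 𝔸.exists_constants
  obtain ⟨S, hS, hS', s, hs, T, hT, hTS⟩ := 𝔸.exists_substitutions
  obtain ⟨i, hi, hi'⟩ := 𝔸.exists_id
  have hi'' : ∀ x, x ∈ 𝔸.app i x := fun x => Part.eq_some_iff.1 (hi' x)
  have app_pair : ∀ a b z q r, q ∈ 𝔸.app z a → r ∈ 𝔸.app q b →
      r ∈ 𝔸.app (S (S i (K a)) (K b)) z := fun a b z q r hq hr =>
    hS _ _ _ _ _ _ (hS _ _ _ _ _ _ (hi'' z) (hK a z) hq) (hK b z) hr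
  have const : ∀ f ∈ 𝔸.sharp, ∃ e ∈ 𝔸.sharp, ∀ x a, a ∈ 𝔸.app f x → K a ∈ 𝔸.app e x :=
    fun f hf => ⟨S (K k) f, hS' _ (hK' k hk) f hf, fun x a ha =>
      hS _ _ _ _ _ _ (hK k x) ha (hkK a)⟩
  have subst : ∀ f ∈ 𝔸.sharp, ∀ g ∈ 𝔸.sharp, ∃ e ∈ 𝔸.sharp, ∀ x a b, a ∈ 𝔸.app f x →
      b ∈ 𝔸.app g x → S a b ∈ 𝔸.app e x := fun f hf g hg =>
    ⟨S (S (K s) f) g, hS' _ (hS' _ (hK' s hs) f hf) g hg, fun x a b ha hb =>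
      hS _ _ _ _ _ _ (hS _ _ _ _ _ _ (hK s x) ha (hT a)) hb (hTS a b)⟩
  -- The Church pair `λz. z a b`; its projections apply it to `k` and to `K i`, which select the
  -- first and the second argument.
  refine ⟨fun a b => S (S i (K a)) (K b), ⟨S i (K k), hS' i hi _ (hK' k hk), fun a b => ?_⟩,
    ⟨S i (K (K i)), hS' i hi _ (hK' _ (hK' i hi)), fun a b => ?_⟩, fun f hf g hg => ?_⟩
  · exact hS _ _ _ _ _ _ (hi'' _) (hK k _) (app_pair a b k _ a (hkK a) (hK a b))
  · exact hS _ _ _ _ _ _ (hi'' _) (hK (K i) _) (app_pair a b (K i) _ b (hK i a) (hi'' b))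
  · obtain ⟨f', hf', hf''⟩ := const f hf
    obtain ⟨g', hg', hg''⟩ := const g hg
    obtain ⟨f₂, hf₂, hf₂'⟩ := subst _ (hK' i hi) f' hf'
    obtain ⟨e, he, he'⟩ := subst f₂ hf₂ g' hg'
    exact ⟨e, he, fun x a b ha hb => he' _ _ _ (hf₂' _ _ _ (hK i x) (hf'' x a ha)) (hg'' x b hb)⟩

-- Prime predicates of the realizability tripos

theorem realizabilityTripos_isExists {I J : Type u} (f : J → I) (φ : J → Set A) :
    𝔸.realizabilityTripos.IsExists f φ (fun i : I => {a | ∃ j, f j = i ∧ a ∈ φ j}) := by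
  intro ψ
  constructor
  · rintro ⟨e, he, h⟩
    exact ⟨e, he, fun j a ha => h (f j) a ⟨j, rfl, ha⟩⟩
  · rintro ⟨e, he, h⟩
    refine ⟨e, he, ?_⟩
    rintro _ a ⟨j, rfl, ha⟩
    exact h j a ha

/-- The predicate on `I` with the only realizer `f i` at `i`. -/
def singletonPred {I : Type u} (f : I → A) : 𝔸.realizabilityTripos.Pred I := fun i => {f i}

variable {𝔸}

theorem singletonPred_le_iff {I : Type u} {f : I → A} {φ : 𝔸.realizabilityTripos.Pred I} :
    𝔸.singletonPred f ≤ φ ↔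
      ∃ e ∈ 𝔸.sharp, ∀ i, ∃ b ∈ 𝔸.app e (f i), b ∈ (show I → Set A from φ) i :=
  ⟨fun ⟨e, he, h⟩ => ⟨e, he, fun i => h i _ rfl⟩,
    fun ⟨e, he, h⟩ => ⟨e, he, by rintro i _ rfl; exact h i⟩⟩

theorem singletonPred_le_singletonPred_iff {I : Type u} {f g : I → A} :
    𝔸.singletonPred f ≤ 𝔸.singletonPred g ↔ ∃ e ∈ 𝔸.sharp, ∀ i, g i ∈ 𝔸.app e (f i) := by
  rw [singletonPred_le_iff]
  refine exists_congr fun e => and_congr_right fun _ => forall_congr' fun i => ?_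
  exact ⟨by rintro ⟨_, h, rfl⟩; exact h, fun h => ⟨_, h, rfl⟩⟩

/-- With a single realizer at each index, the output of `e` is determined there, and a witness for
it can be chosen index by index. -/
theorem singletonPred_isExPrime {I : Type u} (f : I → A) :
    𝔸.realizabilityTripos.IsExPrime (𝔸.singletonPred f) := by
  intro J L u v φ χ hχ h
  obtain ⟨e, he, h'⟩ := singletonPred_le_iff (f := f ∘ u).1
    (le_trans h ((hχ _).2 ((𝔸.realizabilityTripos_isExists v φ _).1 le_rfl)))
  choose b hb hb' using h'
  choose s hs hs' using hb'
  exact ⟨s, funext hs, singletonPred_le_iff (f := f ∘ u).2 ⟨e, he, fun j => ⟨b j, hb j, hs' j⟩⟩⟩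

theorem exists_isExists_singletonPred {I : Type u} (φ : 𝔸.realizabilityTripos.Pred I) :
    ∃ (J : Type u) (p : J → I) (f : J → A), (∀ j, f j ∈ (show I → Set A from φ) (p j)) ∧
      𝔸.realizabilityTripos.IsExists p (𝔸.singletonPred f) φ := by
  let S : I → Set A := φ
  refine ⟨{x : I × A // x.2 ∈ S x.1}, fun x => x.1.1, fun x => x.1.2, fun x => x.2, ?_⟩
  have : S = fun i =>
      {a | ∃ j : {x : I × A // x.2 ∈ S x.1}, j.1.1 = i ∧ a ∈ ({j.1.2} : Set A)} := by
    funext i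
    ext a
    exact ⟨fun h => ⟨⟨(i, a), h⟩, rfl, rfl⟩, by rintro ⟨x, rfl, rfl⟩; exact x.2⟩
  have h := 𝔸.realizabilityTripos_isExists (fun x : {x : I × A // x.2 ∈ S x.1} => x.1.1)
    (fun x => {x.1.2})
  rw [← this] at h
  exact h

/-- Write `π` as an existential image of singletons, one for each realizer; primality selects a
realizer `f (s i)` at each `i`, uniformly computable from all realizers of `π`. -/
theorem exists_iso_singletonPred {I : Type u} {π : 𝔸.realizabilityTripos.Pred I}
    (hπ : 𝔸.realizabilityTripos.IsExPrime π) :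
    ∃ f : I → A, 𝔸.realizabilityTripos.Iso (𝔸.singletonPred f) π := by
  obtain ⟨J, p, f, hf, hex⟩ := exists_isExists_singletonPred π
  obtain ⟨s, hs, hs'⟩ := hπ _ _ id p _ π hex le_rfl
  obtain ⟨e, he, he'⟩ := 𝔸.exists_id
  refine ⟨f ∘ s, singletonPred_le_iff.2 ⟨e, he, fun i => ⟨f (s i), ?_, ?_⟩⟩, hs'⟩
  · rw [he']
    exact Part.mem_some _
  · have := hf (s i)
    rwa [show p (s i) = i from congrFun hs i] at this

variable (𝔸)

theorem realizabilityTripos_hasEnoughExPrimes : 𝔸.realizabilityTripos.HasEnoughExPrimes := by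
  intro I φ
  obtain ⟨J, p, f, -, hex⟩ := exists_isExists_singletonPred φ
  exact ⟨J, p, _, singletonPred_isExPrime f, hex⟩

/-- The predicate of `singletonPred`, as an element of the sub-preorder of `∃`-primes. -/
def singletonPrim {I : Type u} (f : I → A) : 𝔸.realizabilityTripos.prim.Pred I :=
  ⟨𝔸.singletonPred f, singletonPred_isExPrime f⟩

theorem singletonPrim_isGeneric :
    𝔸.realizabilityTripos.prim.IsGeneric (𝔸.singletonPrim (id : A → A)) := fun _ φ =>
  exists_iso_singletonPred φ.2

theorem singletonPrim_isDiscrete :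
    𝔸.realizabilityTripos.prim.IsDiscrete (𝔸.singletonPrim (id : A → A)) := by
  intro J L e f φ he h
  obtain ⟨g, hg⟩ := exists_iso_singletonPred φ.2
  have h' : 𝔸.singletonPred (g ∘ e) ≤ 𝔸.singletonPred f :=
    le_trans ((𝔸.realizabilityTripos.reindex e).monotone hg.1) h
  obtain ⟨r, -, hr⟩ := singletonPred_le_singletonPred_iff.1 h'
  obtain ⟨s, hs⟩ := he.hasRightInverse
  -- Here `r` computes `f l` from `g (e l)`, so `f` is constant on the fibers of `e`.
  refine ⟨f ∘ s, funext fun l => Part.mem_unique (hr (s (e l))) ?_⟩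
  have := hr l
  rwa [Function.comp_apply, ← hs (e l)] at this

theorem realizabilityTripos_prim_hasFiniteMeets :
    𝔸.realizabilityTripos.prim.HasFiniteMeets := by
  obtain ⟨p, ⟨fst, hfst, hfst'⟩, ⟨snd, hsnd, hsnd'⟩, hp⟩ := 𝔸.exists_pairing
  obtain ⟨K, hK, hK', k, hk, -⟩ := 𝔸.exists_constants
  have top : ∀ I : Type u, IsTop (𝔸.singletonPrim fun _ : I => k) := fun I φ =>
    ⟨K k, hK' k hk, fun i a _ => ⟨k, hK k a, rfl⟩⟩
  have inf : ∀ {I : Type u} (f g : I → A), IsGLB {𝔸.singletonPrim f, 𝔸.singletonPrim g}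
      (𝔸.singletonPrim fun i => p (f i) (g i)) := by
    intro I f g
    refine isGLB_pair_iff.2 ⟨⟨singletonPred_le_singletonPred_iff.2 ⟨fst, hfst, fun i => hfst' _ _⟩,
      singletonPred_le_singletonPred_iff.2 ⟨snd, hsnd, fun i => hsnd' _ _⟩⟩, ?_⟩
    rintro φ ⟨e₁, he₁, h₁⟩ ⟨e₂, he₂, h₂⟩
    obtain ⟨e, he, h⟩ := hp e₁ he₁ e₂ he₂
    refine ⟨e, he, fun i a ha => ⟨_, h a (f i) (g i) ?_ ?_, rfl⟩⟩
    · obtain ⟨_, hb, rfl⟩ := h₁ i a ha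
      exact hb
    · obtain ⟨_, hb, rfl⟩ := h₂ i a ha
      exact hb
  have iso : ∀ {I : Type u} (φ : 𝔸.realizabilityTripos.prim.Pred I), ∃ f : I → A,
      𝔸.realizabilityTripos.prim.Iso (𝔸.singletonPrim f) φ := fun φ =>
    exists_iso_singletonPred φ.2
  have reindex : ∀ {I J : Type u} (f : J → I) {φ ψ : 𝔸.realizabilityTripos.prim.Pred I},
      𝔸.realizabilityTripos.prim.Iso φ ψ → 𝔸.realizabilityTripos.prim.Iso
        (𝔸.realizabilityTripos.prim.reindex f φ) (𝔸.realizabilityTripos.prim.reindex f ψ) :=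
    fun f _ _ h => ⟨OrderHom.monotone _ h.1, OrderHom.monotone _ h.2⟩
  refine ⟨fun I => ⟨_, top I⟩, fun I φ ψ => ?_, fun {I J} f t ht φ => ?_,
    fun {I J} f φ ψ m hm => ?_⟩
  · obtain ⟨f, hf⟩ := iso φ
    obtain ⟨g, hg⟩ := iso ψ
    exact ⟨_, (inf f g).pair_congr hf hg .rfl⟩
  · have : 𝔸.singletonPrim (fun _ : J => k) ≤ 𝔸.realizabilityTripos.prim.reindex f t :=
      OrderHom.monotone (𝔸.realizabilityTripos.prim.reindex f) (ht (𝔸.singletonPrim fun _ => k))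
    exact (top J φ).trans this
  · obtain ⟨g, hg⟩ := iso φ
    obtain ⟨h, hh⟩ := iso ψ
    have e := (inf g h).pair_congr hg hh .rfl
    exact (inf (g ∘ f) (h ∘ f)).pair_congr (reindex f hg) (reindex f hh)
      (reindex f ⟨hm.2 e.1, e.2 hm.1⟩)

end RelPCA

theorem theorem8p6 (P : IndexedPreorder.{u, v}) (hP : P.IsTripos) :
    (∃ (A : Type u) (𝔸 : RelPCA A), P.IsEquivalent 𝔸.realizabilityTripos) ↔
      (P.HasEnoughExPrimes ∧ P.prim.HasFiniteMeets ∧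
        ∃ (A : Type u) (δ : P.prim.Pred A), P.prim.IsGeneric δ ∧ P.prim.IsDiscrete δ) := by
  constructor
  · rintro ⟨A, 𝔸, F, G, hGF, hFG⟩
    let E : IndexedPreorder.Equivalence 𝔸.realizabilityTripos P := ⟨G, F, hFG, hGF⟩
    exact ⟨E.hasEnoughExPrimes 𝔸.realizabilityTripos_hasEnoughExPrimes,
      E.prim.hasFiniteMeets 𝔸.realizabilityTripos_prim_hasFiniteMeets, A, _,
      E.prim.isGeneric 𝔸.singletonPrim_isGeneric, E.prim.isDiscrete 𝔸.singletonPrim_isDiscrete⟩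
  · rintro ⟨hE, hM, A, δ, hδ, hδ'⟩
    exact ⟨A, IndexedPreorder.exists_isEquivalent_realizabilityTripos hP hE hM hδ hδ'⟩
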